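/- For $\operatorname{Re} z>0$ let $$A(z)=\int_0^\infty e^{-t}\,\frac{t^{z+1}-(-1)^z t}{t+1}\,dt ,\qquad (-1)^z=e^{\pi i z},$$ and continue $A$ meromorphically to $\mathbb C$ by $A(z)=\Gamma(z+2)-A(z+1)$ (the alternating Kurepa function). For a function $f$ defined near $a$, except possibly at $a$, let $$\operatorname*{p.v.}_{z=a} f(z)=\lim_{\rho\to0+}\frac1{2\pi i}\oint_{|z-a|=\rho}\frac{f(z)}{z-a}\,dz .$$ Let $\gamma$ be Euler's constant and $$C=e\sum_{n=1}^\infty\frac{(-1)^{n-1}}{n!\,n}-1-e\gamma ,$$ where the series converges. (a) For every $z\in\mathbb C\setminus\mathbb Z$ the series $A_1(z)=\sum_{n=0}^\infty(-1)^n\Gamma(z+1-n)$ converges absolutely and $$A(z)=C\,(-1)^z+\frac{\pi e}{\sin \pi z}+\sum_{n=0}^\infty(-1)^n\,\Gamma(z+1-n).$$ (b) For every $m\in\mathbb Z$ the formula holds in the sense of principal values at the point: all principal values below exist, the series converges absolutely, and $$\operatorname*{p.v.}_{z=m}A(z)=C\,(-1)^m+\operatorname*{p.v.}_{z=m}\frac{\pi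 e}{\sin\pi z}+\operatorname*{p.v.}_{z=m}A_1(z),\qquad \operatorname*{p.v.}_{z=m}A_1(z)=\sum_{n=0}^\infty(-1)^n\operatorname*{p.v.}_{z=m}\Gamma(z+1-n).$$ -/

import Mathlib

/-- The integral `∫₀^∞ e^{-t} (t^{z+1} - (-1)^z t) / (t + 1) dt`, convergent for `Re z > 0`.
Powers are principal; in particular `(-1)^z = exp (π i z)`. -/
noncomputable def kurepaIntegral (z : ℂ) : ℂ :=
  ∫ t in Set.Ioi (0 : ℝ),
    Complex.exp (-(t : ℂ)) * (((t : ℂ) ^ (z + 1) - (-1 : ℂ) ^ z * (t : ℂ)) / ((t : ℂ) + 1))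

/-- `n` applications of `A(z) = Γ(z + 2) - A(z + 1)`, starting from the integral. -/
noncomputable def kurepaStep : ℕ → ℂ → ℂ
  | 0, z => kurepaIntegral z
  | n + 1, z => Complex.Gamma (z + 2) - kurepaStep n (z + 1)

/-- The alternating Kurepa function: the integral for `Re z > 0`, and its continuation to
`Re z ≤ 0` by `A(z) = Γ(z + 2) - A(z + 1)`. The number of steps is the least `n` such that
`Re z + n > 0` (so it is `0` if `Re z > 0`). The values at the poles `z = -2, -3, …`
have no meaning. -/
noncomputable def alternatingKurepa (z : ℂ) : ℂ :=
  kurepaStep (⌊-z.re⌋ + 1).toNat z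

/-- The series `A₁(z) = ∑_{n ≥ 0} (-1)^n Γ(z + 1 - n)`, for `z` not an integer. -/
noncomputable def alternatingGammaSum (z : ℂ) : ℂ :=
  ∑' n : ℕ, (-1 : ℂ) ^ n * Complex.Gamma (z + 1 - n)

/-- The principal value of `f` at the point `a` exists and equals `c`:
`c = lim_{ρ → 0+} (1 / 2πi) ∮_{|z - a| = ρ} f(z) / (z - a) dz`,
where the integrand is integrable on all sufficiently small circles. -/
def HasPrincipalValue (f : ℂ → ℂ) (a c : ℂ) : Prop :=
  (∀ᶠ ρ : ℝ in nhdsWithin 0 (Set.Ioi 0), CircleIntegrable (fun z => f z / (z - a)) a ρ) ∧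
  Filter.Tendsto
    (fun ρ : ℝ => 1 / (2 * (Real.pi : ℂ) * Complex.I) * ∮ z in C(a, ρ), f z / (z - a))
    (nhdsWithin 0 (Set.Ioi 0)) (nhds c)

/-- The principal value at a point is unique. -/
theorem HasPrincipalValue.unique {f : ℂ → ℂ} {a c d : ℂ}
    (hc : HasPrincipalValue f a c) (hd : HasPrincipalValue f a d) : c = d :=
  tendsto_nhds_unique hc.2 hd.2

/-- The constant `e ∑_{n ≥ 1} (-1)^(n-1) / (n! n) - 1 - e γ`; the series is indexed by `n - 1`. -/
noncomputable def slavicConstant : ℂ :=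
  Complex.exp 1 * (∑' n : ℕ, (-1 : ℂ) ^ n / ((Nat.factorial (n + 1) : ℂ) * ((n : ℂ) + 1))) - 1
    - Complex.exp 1 * (Real.eulerMascheroniConstant : ℂ)

/-! Both sides are compared with `e Γ(s) E_s(1)` at `s = z + 2`, where `E_s(1) = ∫₁^∞ e^{-v} v^{-s}
dv`.

Integral side: Fubini gives `∫₀^∞ e^{-t} t^{s-1}/(t+1) dt = e Γ(s) E_s(1)` for `Re s > 0`. The
integral for `A` is this transform at `z + 2` minus `(-1)^z` times its value at `2`, and that value
is `-C` by the expansion of `E₁(1)`. Hence `A(z) = C (-1)^z + e Γ(z+2) E_{z+2}(1)` for `Re z > 0`.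
The recurrence `s E_{s+1}(1) = e⁻¹ - E_s(1)` carries this to all non-integers.

Series side: for `Re s < 1`, `E_s(1)` is `Γ(1-s)` minus an integral over `(0,1]`. After
multiplication by `e Γ(s)`, reflection turns the first part into `πe / sin πs`. In the second,
expanding `e^{1-v}` in powers of `1 - v` gives beta integrals, which reflection turns into `(-1)^n
Γ(s-1-n)`. The same recurrence removes the bound on `Re s`.

At an integer, the identity holds on every circle of radius below one. There the series converges
uniformly and each term has a circle integral independent of the radius, so principal values reduce
to integrals over one circle. -/

open MeasureTheory Set Filter Topology

/-! ### The exponential integral and its recurrence -/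

/-- The exponential integral `E_s(1) = ∫₁^∞ e^{-v} v^{-s} dv`, an entire function of `s`. -/
noncomputable def expIntegralAtOne (s : ℂ) : ℂ :=
  ∫ v in Ioi (1 : ℝ), Complex.exp (-(v : ℂ)) * (v : ℂ) ^ (-s)

theorem integrableOn_exp_neg_mul_cpow_Ioi_one (s : ℂ) :
    IntegrableOn (fun v : ℝ => Complex.exp (-(v : ℂ)) * (v : ℂ) ^ (-s)) (Ioi 1) := by
  -- For `v > 1`, `v ^ |Re s|` dominates `v ^ (-Re s)`; the shift by `1` makes the Gamma exponent
  -- positive.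
  have hG : IntegrableOn (fun v : ℝ => Real.exp (-v) * v ^ ((|s.re| + 1) - 1)) (Ioi 1) :=
    (Real.GammaIntegral_convergent (by positivity)).mono_set (Ioi_subset_Ioi zero_le_one)
  refine hG.mono' ?_ ?_
  · refine ContinuousOn.aestronglyMeasurable ?_ measurableSet_Ioi
    refine ContinuousOn.mul (by fun_prop) ?_
    exact Complex.continuous_ofReal.continuousOn.cpow_const
      fun v hv => Or.inl (by simpa using zero_lt_one.trans (mem_Ioi.1 hv))
  · refine (ae_restrict_iff' measurableSet_Ioi).2 (.of_forall fun v hv => ?_)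
    have hv1 : (1 : ℝ) < v := hv
    rw [norm_mul, Complex.norm_exp, Complex.norm_cpow_eq_rpow_re_of_pos (by linarith)]
    simp only [Complex.neg_re, Complex.ofReal_re]
    gcongr
    · exact hv1.le
    · linarith [neg_abs_le s.re]

/-- Integration by parts. With `Γ(s + 1) = s Γ(s)`, this drives both inductions on the real part. -/
theorem expIntegralAtOne_add_one (s : ℂ) :
    s * expIntegralAtOne (s + 1) = Complex.exp (-1) - expIntegralAtOne s := by
  have hd : ∀ v ∈ Ioi (1 : ℝ), HasDerivAt (fun v : ℝ => -(Complex.exp (-(v : ℂ)) * (v : ℂ) ^ (-s)))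
      (Complex.exp (-(v : ℂ)) * (v : ℂ) ^ (-s) +
        s * (Complex.exp (-(v : ℂ)) * (v : ℂ) ^ (-(s + 1)))) v := by
    intro v hv
    have hv0 : (v : ℂ) ∈ Complex.slitPlane := by
      simpa using zero_lt_one.trans (mem_Ioi.1 hv)
    have h1 : HasDerivAt (fun v : ℂ => -(Complex.exp (-v) * v ^ (-s)))
        (Complex.exp (-(v : ℂ)) * (v : ℂ) ^ (-s) +
          s * (Complex.exp (-(v : ℂ)) * (v : ℂ) ^ (-(s + 1)))) (v : ℂ) := by
      have h2 := (((hasDerivAt_id (v : ℂ)).neg.cexp).mul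
        ((hasDerivAt_id (v : ℂ)).cpow_const (c := -s) hv0)).neg
      refine h2.congr_deriv ?_
      simp only [Pi.neg_apply, id]
      rw [show -s - 1 = -(s + 1) by ring]
      ring
    exact h1.comp_ofReal
  have hi := integrableOn_exp_neg_mul_cpow_Ioi_one s
  have hi' := (integrableOn_exp_neg_mul_cpow_Ioi_one (s + 1)).const_mul s
  have ht : Tendsto (fun v : ℝ => -(Complex.exp (-(v : ℂ)) * (v : ℂ) ^ (-s))) atTop (𝓝 0) := by
    rw [← neg_zero]
    refine Tendsto.neg ?_
    rw [tendsto_zero_iff_norm_tendsto_zero]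
    have h := tendsto_rpow_mul_exp_neg_mul_atTop_nhds_zero (-s.re) 1 one_pos
    refine h.congr' ?_
    filter_upwards [eventually_gt_atTop 0] with v hv
    rw [norm_mul, Complex.norm_exp, Complex.norm_cpow_eq_rpow_re_of_pos hv]
    simp [mul_comm]
  have h := integral_Ioi_of_hasDerivAt_of_tendsto (f := fun v : ℝ =>
      -(Complex.exp (-(v : ℂ)) * (v : ℂ) ^ (-s))) ?_ hd (hi.add hi') ht
  · rw [integral_add hi hi', integral_const_mul] at h
    simp only [Complex.ofReal_one, Complex.one_cpow] at h
    unfold expIntegralAtOne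
    linear_combination h
  · refine ContinuousAt.continuousWithinAt ?_
    refine (ContinuousAt.mul (by fun_prop) ?_).neg
    exact Complex.continuous_ofReal.continuousAt.cpow continuousAt_const (by simp)

/-! ### The Stieltjes transform of the Gamma density -/

/-- The Stieltjes transform `∫₀^∞ e^{-t} t^{s-1} / (t + 1) dt`, convergent for `Re s > 0`. -/
noncomputable def gammaStieltjes (s : ℂ) : ℂ :=
  ∫ t in Ioi (0 : ℝ), Complex.exp (-(t : ℂ)) * ((t : ℂ) ^ (s - 1) / ((t : ℂ) + 1))

theorem integrableOn_gammaStieltjes {s : ℂ} (hs : 0 < s.re) :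
    IntegrableOn (fun t : ℝ => Complex.exp (-(t : ℂ)) * ((t : ℂ) ^ (s - 1) / ((t : ℂ) + 1)))
      (Ioi 0) := by
  have hG := (Real.GammaIntegral_convergent hs)
  refine hG.mono' ?_ ?_
  · refine ContinuousOn.aestronglyMeasurable ?_ measurableSet_Ioi
    refine ContinuousOn.mul (by fun_prop) (ContinuousOn.div ?_ (by fun_prop) ?_)
    · exact Complex.continuous_ofReal.continuousOn.cpow_const
        fun v hv => Or.inl (by simpa using hv)
    · intro t ht
      have : (0 : ℝ) < t + 1 := by linarith [mem_Ioi.1 ht]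
      exact_mod_cast this.ne'
  · refine (ae_restrict_iff' measurableSet_Ioi).2 (.of_forall fun t ht => ?_)
    have ht0 : (0 : ℝ) < t := ht
    rw [norm_mul, norm_div, Complex.norm_exp, Complex.norm_cpow_eq_rpow_re_of_pos ht0]
    have h1 : ‖(t : ℂ) + 1‖ = t + 1 := by
      rw [← Complex.ofReal_one, ← Complex.ofReal_add, Complex.norm_real, Real.norm_of_nonneg]
      linarith
    rw [h1]
    simp only [Complex.neg_re, Complex.ofReal_re, Complex.sub_re, Complex.one_re]
    gcongr
    exact div_le_self (by positivity) (by linarith)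

/-- Write `e^{-(1+t)}/(1+t) = ∫₁^∞ e^{-v(1+t)} dv` and swap the integrals: the `t`-integral is then
`Γ(s) v^{-s} e^{-v}`. -/
theorem gammaStieltjes_eq_Gamma_mul_expIntegralAtOne {s : ℂ} (hs : 0 < s.re) :
    gammaStieltjes s = Complex.exp 1 * Complex.Gamma s * expIntegralAtOne s := by
  set f : ℝ → ℝ → ℂ := fun t v => (t : ℂ) ^ (s - 1) * Complex.exp ((-(v * (1 + t)) : ℝ) : ℂ) with hf
  have inner_v : ∀ t ∈ Ioi (0 : ℝ), ∫ v in Ioi (1 : ℝ), f t v =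
      Complex.exp (-1) * (Complex.exp (-(t : ℂ)) * ((t : ℂ) ^ (s - 1) / ((t : ℂ) + 1))) := by
    intro t ht
    have ht0 : (0 : ℝ) < t := ht
    have hne : (t : ℂ) + 1 ≠ 0 := by exact_mod_cast (by positivity : t + 1 ≠ 0)
    have h := integral_exp_mul_complex_Ioi (a := -((1 : ℂ) + t)) (by simp; linarith) 1
    simp only [hf]
    rw [integral_const_mul]
    have e1 : ∀ v : ℝ, Complex.exp ((-(v * (1 + t)) : ℝ) : ℂ) = Complex.exp (-((1 : ℂ) + t) * v) := by
      intro v; congr 1; push_cast; ring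
    simp_rw [e1]
    rw [h, show -((1 : ℂ) + t) * ((1 : ℝ) : ℂ) = -1 + -t by push_cast; ring, Complex.exp_add]
    have hne' : (1 : ℂ) + t ≠ 0 := by rwa [add_comm]
    field_simp
    ring
  have inner_t : ∀ v ∈ Ioi (1 : ℝ), ∫ t in Ioi (0 : ℝ), f t v =
      Complex.Gamma s * (Complex.exp (-(v : ℂ)) * (v : ℂ) ^ (-s)) := by
    intro v hv
    have hv0 : (0 : ℝ) < v := zero_lt_one.trans hv
    have h := Complex.integral_cpow_mul_exp_neg_mul_Ioi hs hv0
    have e1 : ∀ t : ℝ, f t v = Complex.exp (-(v : ℂ)) *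
        ((t : ℂ) ^ (s - 1) * Complex.exp (-((v : ℂ) * t))) := by
      intro t
      simp only [hf]
      rw [show (((-(v * (1 + t)) : ℝ)) : ℂ) = -v + -(v * t) by push_cast; ring, Complex.exp_add]
      ring
    simp_rw [e1]
    rw [integral_const_mul, h, one_div, Complex.inv_cpow_eq_ite, if_neg, Complex.cpow_neg]
    · ring
    · rw [Complex.arg_ofReal_of_nonneg hv0.le]; exact Real.pi_ne_zero.symm
  have hmeas : AEStronglyMeasurable (Function.uncurry f)
      ((volume.restrict (Ioi (0 : ℝ))).prod (volume.restrict (Ioi (1 : ℝ)))) := by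
    rw [Measure.prod_restrict]
    refine ContinuousOn.aestronglyMeasurable ?_ (measurableSet_Ioi.prod measurableSet_Ioi)
    refine ContinuousOn.mul ?_ (by fun_prop)
    refine ContinuousOn.cpow_const (by fun_prop) fun p hp => Or.inl ?_
    simpa using hp.1
  have hnorm : ∀ t ∈ Ioi (0 : ℝ), ∀ v, ‖f t v‖ = t ^ (s.re - 1) * Real.exp (-(1 + t) * v) := by
    intro t ht v
    simp only [hf]
    rw [norm_mul, Complex.norm_exp, Complex.norm_cpow_eq_rpow_re_of_pos ht]
    simp only [Complex.ofReal_re, Complex.sub_re, Complex.one_re]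
    congr 2
    ring
  have hint : Integrable (Function.uncurry f)
      ((volume.restrict (Ioi (0 : ℝ))).prod (volume.restrict (Ioi (1 : ℝ)))) := by
    rw [integrable_prod_iff hmeas]
    constructor
    · refine (ae_restrict_iff' measurableSet_Ioi).2 (.of_forall fun t ht => ?_)
      have ht0 : (0 : ℝ) < t := ht
      have hi : IntegrableOn (fun v : ℝ => t ^ (s.re - 1) * Real.exp (-(1 + t) * v)) (Ioi 1) :=
        (integrableOn_exp_mul_Ioi (by linarith) 1).const_mul _
      refine (integrable_norm_iff ?_).1 (hi.congr (.of_forall fun v => (hnorm t ht v).symm))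
      exact (by simp only [Function.uncurry, hf]; fun_prop :
        Continuous fun v => Function.uncurry f (t, v)).aestronglyMeasurable
    · have hG := (integrableOn_gammaStieltjes hs).norm.const_mul (Real.exp (-1))
      refine hG.congr ((ae_restrict_iff' measurableSet_Ioi).2 (.of_forall fun t ht => ?_))
      have ht0 : (0 : ℝ) < t := ht
      simp only [Function.uncurry]
      simp_rw [hnorm t ht]
      rw [integral_const_mul, integral_exp_mul_Ioi (by linarith)]
      rw [norm_mul, norm_div, Complex.norm_exp, Complex.norm_cpow_eq_rpow_re_of_pos ht0]
      have h1 : ‖(t : ℂ) + 1‖ = t + 1 := by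
        rw [← Complex.ofReal_one, ← Complex.ofReal_add, Complex.norm_real, Real.norm_of_nonneg]
        linarith
      rw [h1, show -(1 + t) * 1 = -1 + -t by ring, Real.exp_add]
      simp only [Complex.neg_re, Complex.ofReal_re, Complex.sub_re, Complex.one_re]
      have : 1 + t ≠ 0 := by positivity
      have : t + 1 ≠ 0 := by positivity
      field_simp
      ring
  have hswap := integral_integral_swap hint
  rw [setIntegral_congr_fun measurableSet_Ioi inner_v,
    setIntegral_congr_fun measurableSet_Ioi inner_t, integral_const_mul, integral_const_mul] at hswap
  unfold gammaStieltjes expIntegralAtOne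
  rw [mul_assoc, ← hswap, ← mul_assoc, ← Complex.exp_add]
  simp

/-! ### The Gamma series -/

/-- Expand `e^{1-v}` in powers of `1 - v`. Since `|1 - v| ≤ 1`, the `n`-th term is at most `1/n!`
times the zeroth, which allows termwise integration. -/
theorem hasSum_betaIntegral_div_factorial {u : ℂ} (hu : 0 < u.re) :
    HasSum (fun n : ℕ => Complex.betaIntegral u (n + 1) / (n.factorial : ℂ))
      (∫ v in Ioc (0 : ℝ) 1, Complex.exp (1 - (v : ℂ)) * (v : ℂ) ^ (u - 1)) := by
  set F : ℕ → ℝ → ℂ := fun n v => (v : ℂ) ^ (u - 1) * (1 - (v : ℂ)) ^ n / (n.factorial : ℂ) with hF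
  have hbeta : ∀ n : ℕ, ∫ v in Ioc (0 : ℝ) 1, F n v =
      Complex.betaIntegral u (n + 1) / (n.factorial : ℂ) := by
    intro n
    rw [Complex.betaIntegral, intervalIntegral.integral_of_le zero_le_one, ← integral_div]
    simp [hF]
  have hint : ∀ n, IntegrableOn (F n) (Ioc 0 1) := by
    intro n
    have h := Complex.betaIntegral_convergent hu (v := n + 1) (by simp; positivity)
    rw [intervalIntegrable_iff_integrableOn_Ioc_of_le zero_le_one] at h
    refine (h.div_const (n.factorial : ℂ)).congr (.of_forall fun v => ?_)
    simp [hF]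
  have hnorm : ∀ n, ∀ v ∈ Ioc (0 : ℝ) 1, ‖F n v‖ ≤ ‖F 0 v‖ * ((n.factorial : ℝ))⁻¹ := by
    intro n v hv
    simp only [hF, norm_div, norm_mul, norm_pow, Complex.norm_natCast]
    have h1 : ‖(1 : ℂ) - v‖ ≤ 1 := by
      rw [← Complex.ofReal_one, ← Complex.ofReal_sub, Complex.norm_real, Real.norm_of_nonneg]
      · linarith [hv.1]
      · linarith [hv.2]
    rw [div_eq_mul_inv]
    gcongr
    simpa using mul_le_mul_of_nonneg_left (pow_le_one₀ (n := n) (norm_nonneg _) h1)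
      (norm_nonneg ((v : ℂ) ^ (u - 1)))
  have hsum : Summable fun n => ∫ v in Ioc (0 : ℝ) 1, ‖F n v‖ := by
    have hs : Summable fun n : ℕ => (∫ v in Ioc (0 : ℝ) 1, ‖F 0 v‖) * ((n.factorial : ℝ))⁻¹ := by
      refine Summable.mul_left _ ?_
      simpa using Real.summable_pow_div_factorial 1
    refine hs.of_nonneg_of_le (fun n => integral_nonneg fun v => norm_nonneg _) fun n => ?_
    rw [← integral_mul_const]
    exact setIntegral_mono_on (hint n).norm ((hint 0).norm.mul_const _) measurableSet_Ioc (hnorm n)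
  have h := hasSum_integral_of_summable_integral_norm hint hsum
  simp_rw [hbeta] at h
  rw [setIntegral_congr_fun measurableSet_Ioc (g := fun v => ∑' n, F n v)]
  · exact h
  intro v _
  have he := NormedSpace.expSeries_div_hasSum_exp (1 - (v : ℂ))
  rw [← Complex.exp_eq_exp_ℂ] at he
  have := (he.mul_left ((v : ℂ) ^ (u - 1))).tsum_eq
  simp only [hF, mul_div_assoc]
  rw [this, mul_comm]

/-- Euler's integral for `Γ(1 - s)` is split at `v = 1`. -/
theorem exp_mul_expIntegralAtOne_eq {s : ℂ} (hs : s.re < 1) :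
    Complex.exp 1 * expIntegralAtOne s = Complex.exp 1 * Complex.Gamma (1 - s) -
      ∫ v in Ioc (0 : ℝ) 1, Complex.exp (1 - (v : ℂ)) * (v : ℂ) ^ ((1 - s) - 1) := by
  have hu : 0 < (1 - s).re := by simpa using hs
  have hG := Complex.GammaIntegral_convergent hu
  have h : Complex.Gamma (1 - s) =
      (∫ v in Ioc (0 : ℝ) 1, Complex.exp (-(v : ℂ)) * (v : ℂ) ^ ((1 - s) - 1)) +
        expIntegralAtOne s := by
    rw [Complex.Gamma_eq_integral hu, Complex.GammaIntegral, ← Ioc_union_Ioi_eq_Ioi zero_le_one,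
      setIntegral_union (Ioc_disjoint_Ioi le_rfl) measurableSet_Ioi
        (hG.mono_set Ioc_subset_Ioi_self) (hG.mono_set (Ioi_subset_Ioi zero_le_one)),
      expIntegralAtOne]
    simp
  simp_rw [show ∀ v : ℝ, Complex.exp (1 - (v : ℂ)) = Complex.exp 1 * Complex.exp (-(v : ℂ)) from
    fun v => by rw [sub_eq_add_neg, Complex.exp_add], mul_assoc, integral_const_mul]
  rw [h]
  ring

theorem Gamma_ne_zero_of_forall_ne_int {s : ℂ} (hs : ∀ m : ℤ, s ≠ m) : Complex.Gamma s ≠ 0 :=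
  Complex.Gamma_ne_zero fun m => by simpa using hs (-m)

theorem sub_int_ne_int {s : ℂ} (hs : ∀ m : ℤ, s ≠ m) (k m : ℤ) : s - k ≠ m := fun h =>
  hs (m + k) (by push_cast; rw [← h]; ring)

/-- The reflection formula, shifted by an integer. -/
theorem Gamma_sub_nat_mul_Gamma (s : ℂ) (n : ℕ) :
    Complex.Gamma (s - 1 - n) * Complex.Gamma (n + 2 - s) =
      (-1) ^ (n + 1) * (Complex.Gamma s * Complex.Gamma (1 - s)) := by
  have h := Complex.Gamma_mul_Gamma_one_sub (s - 1 - n)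
  have e : Complex.sin (Real.pi * (s - 1 - n)) = (-1) ^ (n + 1) * Complex.sin (Real.pi * s) := by
    have := Complex.sin_antiperiodic.sub_nat_mul_eq (x := Real.pi * s) (n + 1)
    rw [← this]
    congr 1
    push_cast
    ring
  rw [show 1 - (s - 1 - n) = n + 2 - s by ring, e] at h
  rw [h, Complex.Gamma_mul_Gamma_one_sub]
  rcases neg_one_pow_eq_or ℂ (n + 1) with h1 | h1 <;> rw [h1] <;> simp [div_neg]

theorem hasSum_Gamma_sub_of_re_lt_one {s : ℂ} (hre : s.re < 1) (hs : ∀ m : ℤ, s ≠ m) :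
    HasSum (fun n : ℕ => (-1 : ℂ) ^ n * Complex.Gamma (s - 1 - n))
      (Complex.exp 1 * Complex.Gamma s * expIntegralAtOne s -
        Real.pi * Complex.exp 1 / Complex.sin (Real.pi * s)) := by
  have hu : 0 < (1 - s).re := by simpa using hre
  have h := (hasSum_betaIntegral_div_factorial hu).mul_left (-Complex.Gamma s)
  have hterm : ∀ n : ℕ, -Complex.Gamma s * (Complex.betaIntegral (1 - s) (n + 1) / n.factorial) =
      (-1) ^ n * Complex.Gamma (s - 1 - n) := by
    intro n
    have hb := Complex.Gamma_mul_Gamma_eq_betaIntegral hu (t := n + 1) (by simp; positivity)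
    rw [Complex.Gamma_nat_eq_factorial, show 1 - s + (n + 1) = n + 2 - s by ring] at hb
    have hg : Complex.Gamma (n + 2 - s) ≠ 0 := Gamma_ne_zero_of_forall_ne_int fun m hm =>
      hs (n + 2 - m) (by push_cast; rw [← hm]; ring)
    have hr := Gamma_sub_nat_mul_Gamma s n
    have hf : (n.factorial : ℂ) ≠ 0 := by exact_mod_cast n.factorial_ne_zero
    have hsq : ((-1 : ℂ) ^ n) * (-1) ^ n = 1 := by rw [← mul_pow]; simp
    refine mul_right_cancel₀ (mul_ne_zero hg hf) ?_
    rw [show ∀ x g f : ℂ, f ≠ 0 →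
      -Complex.Gamma s * (x / f) * (g * f) = -Complex.Gamma s * x * g from
        fun x g f hf => by field_simp]
    · rw [pow_succ] at hr
      linear_combination Complex.Gamma s * hb - (-1) ^ n * (n.factorial : ℂ) * hr
        + (n.factorial : ℂ) * Complex.Gamma s * Complex.Gamma (1 - s) * hsq
    · exact hf
  simp_rw [hterm] at h
  have h1 := exp_mul_expIntegralAtOne_eq hre
  have h2 := Complex.Gamma_mul_Gamma_one_sub s
  rw [show Real.pi * Complex.exp 1 / Complex.sin (Real.pi * s) =
    Complex.exp 1 * (Real.pi / Complex.sin (Real.pi * s)) by ring, ← h2]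
  rw [← (by linear_combination Complex.Gamma s * h1 :
    Complex.exp 1 * Complex.Gamma s * expIntegralAtOne s -
      Complex.exp 1 * (Complex.Gamma s * Complex.Gamma (1 - s)) =
    -Complex.Gamma s * ∫ v in Ioc (0 : ℝ) 1,
      Complex.exp (1 - (v : ℂ)) * (v : ℂ) ^ ((1 - s) - 1))] at h
  exact h

/-- Passing from `s - 1` to `s` negates the series and prepends the term `Γ(s - 1)`. The closed form
changes in the same way, so induction on an upper bound for `Re s` applies. -/
theorem hasSum_Gamma_sub {s : ℂ} (hs : ∀ m : ℤ, s ≠ m) :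
    HasSum (fun n : ℕ => (-1 : ℂ) ^ n * Complex.Gamma (s - 1 - n))
      (Complex.exp 1 * Complex.Gamma s * expIntegralAtOne s -
        Real.pi * Complex.exp 1 / Complex.sin (Real.pi * s)) := by
  suffices H : ∀ (N : ℕ) (s : ℂ), s.re < N + 1 → (∀ m : ℤ, s ≠ m) →
      HasSum (fun n : ℕ => (-1 : ℂ) ^ n * Complex.Gamma (s - 1 - n))
      (Complex.exp 1 * Complex.Gamma s * expIntegralAtOne s -
        Real.pi * Complex.exp 1 / Complex.sin (Real.pi * s)) by
    obtain ⟨N, hN⟩ := exists_nat_gt s.re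
    exact H N s (by linarith) hs
  intro N
  induction N with
  | zero => exact fun s h => hasSum_Gamma_sub_of_re_lt_one (by simpa using h)
  | succ N ih =>
    intro s hre hs
    have hs' : ∀ m : ℤ, s - 1 ≠ m := by simpa using sub_int_ne_int hs 1
    have h := ih (s - 1) (by simp at hre ⊢; linarith) hs'
    have hne : s - 1 ≠ 0 := by simpa using hs' 0
    have hG := Complex.Gamma_add_one (s - 1) hne
    have hE := expIntegralAtOne_add_one (s - 1)
    have hsin : Complex.sin (Real.pi * (s - 1)) = -Complex.sin (Real.pi * s) := by
      rw [mul_sub, mul_one, Complex.sin_sub_pi]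
    have hexp : Complex.exp 1 * Complex.exp (-1) = 1 := by rw [← Complex.exp_add]; simp
    rw [sub_add_cancel] at hG hE
    rw [← hasSum_nat_add_iff' 1]
    have hterm : ∀ n : ℕ, -((-1 : ℂ) ^ n * Complex.Gamma (s - 1 - 1 - n)) =
        (-1) ^ (n + 1) * Complex.Gamma (s - 1 - (n + 1 : ℕ)) := by
      intro n
      rw [show s - 1 - (n + 1 : ℕ) = s - 1 - 1 - n by push_cast; ring]
      ring
    have hval : -(Complex.exp 1 * Complex.Gamma (s - 1) * expIntegralAtOne (s - 1) -
          Real.pi * Complex.exp 1 / Complex.sin (Real.pi * (s - 1))) =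
        Complex.exp 1 * Complex.Gamma s * expIntegralAtOne s -
          Real.pi * Complex.exp 1 / Complex.sin (Real.pi * s) -
          ∑ i ∈ Finset.range 1, (-1 : ℂ) ^ i * Complex.Gamma (s - 1 - i) := by
      rw [hsin, hG, div_neg]
      simp only [Finset.sum_range_one, pow_zero, Nat.cast_zero, sub_zero, one_mul]
      linear_combination -Complex.exp 1 * Complex.Gamma (s - 1) * hE
        - Complex.Gamma (s - 1) * hexp
    have h' := h.neg
    simp_rw [hterm] at h'
    rwa [hval] at h'

/-! ### The constant -/

theorem summable_slavic :
    Summable (fun n : ℕ => (-1 : ℂ) ^ n / ((Nat.factorial (n + 1) : ℂ) * ((n : ℂ) + 1))) := by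
  refine Summable.of_norm_bounded (Real.summable_pow_div_factorial 1) fun n => ?_
  have h1 : ‖(n : ℂ) + 1‖ = n + 1 := by exact_mod_cast Complex.norm_natCast (n + 1)
  rw [norm_div, norm_mul, norm_pow, norm_neg, norm_one, h1, Complex.norm_natCast]
  have h2 : (n.factorial : ℝ) ≤ (n + 1).factorial := by
    exact_mod_cast Nat.factorial_le n.le_succ
  have h3 : (0 : ℝ) < n.factorial := by exact_mod_cast n.factorial_pos
  rw [one_pow]
  refine one_div_le_one_div_of_le h3 ?_
  nlinarith [(Nat.cast_nonneg n : (0 : ℝ) ≤ n)]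

theorem integral_Ioc_pow_mul_log (k : ℕ) :
    ∫ t in Ioc (0 : ℝ) 1, t ^ k * Real.log t = -1 / ((k : ℝ) + 1) ^ 2 := by
  have hk : (k : ℝ) + 1 ≠ 0 := by positivity
  rw [← intervalIntegral.integral_of_le zero_le_one]
  -- The factor `t * log t` makes the antiderivative visibly continuous at `0`.
  have h := intervalIntegral.integral_eq_sub_of_hasDerivAt_of_le (a := 0) (b := 1)
    (f := fun t : ℝ => t ^ k * (t * Real.log t) / (k + 1) - t ^ (k + 1) / ((k : ℝ) + 1) ^ 2)
    (f' := fun t => t ^ k * Real.log t) zero_le_one ?_ ?_ ?_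
  · rw [h]; simp; ring
  · have := Real.continuous_mul_log
    fun_prop
  · intro t ht
    have ht0 : t ≠ 0 := ht.1.ne'
    have h1 : HasDerivAt (fun t : ℝ => t ^ (k + 1) * Real.log t / (k + 1) -
        t ^ (k + 1) / ((k : ℝ) + 1) ^ 2) (t ^ k * Real.log t) t := by
      refine ((((hasDerivAt_pow (k + 1) t).mul (Real.hasDerivAt_log ht0)).div_const _).sub
        ((hasDerivAt_pow (k + 1) t).div_const _)).congr_deriv ?_
      push_cast
      field_simp
      ring
    refine h1.congr_of_eventuallyEq (.of_forall fun x => ?_)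
    simp only [pow_succ]
    ring
  · exact intervalIntegral.intervalIntegrable_log'.continuousOn_mul (by fun_prop)

theorem hasSum_integral_Ioc_exp_neg_mul_log :
    HasSum (fun n : ℕ => -((-1 : ℝ) ^ n / ((n + 1).factorial * ((n : ℝ) + 1))))
      (∫ t in Ioc (0 : ℝ) 1, Real.exp (-t) * Real.log t) := by
  have hlog : IntegrableOn Real.log (Ioc 0 1) := by
    have := intervalIntegral.intervalIntegrable_log' (a := 0) (b := 1)
    rwa [intervalIntegrable_iff_integrableOn_Ioc_of_le zero_le_one] at this
  set F : ℕ → ℝ → ℝ := fun n t => ((-1) ^ n / n.factorial) * (t ^ n * Real.log t) with hF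
  have hint : ∀ n, IntegrableOn (F n) (Ioc 0 1) := by
    intro n
    have := (intervalIntegral.intervalIntegrable_log' (a := 0) (b := 1)).continuousOn_mul
      (g := fun t : ℝ => t ^ n) (by fun_prop)
    rw [intervalIntegrable_iff_integrableOn_Ioc_of_le zero_le_one] at this
    exact this.const_mul _
  have hsum : Summable fun n => ∫ t in Ioc (0 : ℝ) 1, ‖F n t‖ := by
    have hs : Summable fun n : ℕ =>
        (1 ^ n / (n.factorial : ℝ)) * ∫ t in Ioc (0 : ℝ) 1, ‖Real.log t‖ :=
      (Real.summable_pow_div_factorial 1).mul_right _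
    refine hs.of_nonneg_of_le (fun n => integral_nonneg fun v => norm_nonneg _) fun n => ?_
    rw [← integral_const_mul]
    refine setIntegral_mono_on (hint n).norm (hlog.norm.const_mul _)
      measurableSet_Ioc fun t ht => ?_
    simp only [hF, norm_mul, norm_div, norm_pow, norm_neg, norm_one, Real.norm_natCast]
    gcongr
    refine mul_le_of_le_one_left (norm_nonneg _) (pow_le_one₀ (norm_nonneg _) ?_)
    rw [Real.norm_of_nonneg ht.1.le]
    exact ht.2
  have h := hasSum_integral_of_summable_integral_norm hint hsum
  have hterm : ∀ n, ∫ t in Ioc (0 : ℝ) 1, F n t =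
      -((-1 : ℝ) ^ n / ((n + 1).factorial * ((n : ℝ) + 1))) := by
    intro n
    rw [integral_const_mul, integral_Ioc_pow_mul_log, Nat.factorial_succ]
    have : (n.factorial : ℝ) ≠ 0 := by exact_mod_cast n.factorial_ne_zero
    push_cast
    field_simp
  simp_rw [hterm] at h
  rw [setIntegral_congr_fun measurableSet_Ioc (g := fun v => ∑' n, F n v)]
  · exact h
  intro t _
  have he := NormedSpace.expSeries_div_hasSum_exp (-t)
  rw [← Real.exp_eq_exp_ℝ] at he
  change Real.exp (-t) * Real.log t = ∑' n, F n t
  rw [← (he.mul_right (Real.log t)).tsum_eq]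
  refine tsum_congr fun n => ?_
  simp only [hF]
  rw [neg_pow t]
  ring

theorem integrableOn_Ioc_exp_neg_mul_log :
    IntegrableOn (fun t : ℝ => Real.exp (-t) * Real.log t) (Ioc 0 1) := by
  have h := (intervalIntegral.intervalIntegrable_log' (a := 0) (b := 1)).continuousOn_mul
    (g := fun t : ℝ => Real.exp (-t)) (by fun_prop)
  rwa [intervalIntegrable_iff_integrableOn_Ioc_of_le zero_le_one] at h

theorem integrableOn_Ioi_one_exp_neg_mul_log :
    IntegrableOn (fun t : ℝ => Real.exp (-t) * Real.log t) (Ioi 1) := by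
  have hG : IntegrableOn (fun v : ℝ => Real.exp (-v) * v ^ ((2 : ℝ) - 1)) (Ioi 1) :=
    (Real.GammaIntegral_convergent (by positivity)).mono_set (Ioi_subset_Ioi zero_le_one)
  refine hG.mono' ?_ ?_
  · refine ContinuousOn.aestronglyMeasurable ?_ measurableSet_Ioi
    refine ContinuousOn.mul (by fun_prop) (Real.continuousOn_log.mono fun t ht => ?_)
    exact (zero_lt_one.trans (mem_Ioi.1 ht)).ne'
  · refine (ae_restrict_iff' measurableSet_Ioi).2 (.of_forall fun t ht => ?_)
    have ht1 : (1 : ℝ) < t := ht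
    rw [norm_mul, Real.norm_of_nonneg (Real.exp_pos _).le,
      Real.norm_of_nonneg (Real.log_nonneg ht1.le)]
    have := Real.log_le_sub_one_of_pos (zero_lt_one.trans ht1)
    rw [show (2 : ℝ) - 1 = 1 by norm_num, Real.rpow_one]
    gcongr
    linarith

/-- Integration by parts; the boundary terms vanish because `log 1 = 0` and `e^{-t}` decays. -/
theorem integral_Ioi_one_exp_neg_mul_log :
    ((∫ t in Ioi (1 : ℝ), Real.exp (-t) * Real.log t : ℝ) : ℂ) = expIntegralAtOne 1 := by
  have hE : expIntegralAtOne 1 = ((∫ t in Ioi (1 : ℝ), Real.exp (-t) * t⁻¹ : ℝ) : ℂ) := by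
    rw [expIntegralAtOne, ← integral_complex_ofReal]
    refine integral_congr_ae (.of_forall fun t => ?_)
    simp [Complex.cpow_neg_one]
  have hi : IntegrableOn (fun t : ℝ => Real.exp (-t) * t⁻¹) (Ioi 1) := by
    have h := (integrableOn_exp_neg_mul_cpow_Ioi_one 1).re
    refine h.congr (.of_forall fun t => ?_)
    simp only [Complex.cpow_neg_one, ← Complex.ofReal_neg, ← Complex.ofReal_exp,
      ← Complex.ofReal_inv, ← Complex.ofReal_mul]
    exact Complex.ofReal_re _
  rw [hE]
  congr 1
  have hl := integrableOn_Ioi_one_exp_neg_mul_log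
  have ht : Tendsto (fun t : ℝ => Real.exp (-t) * Real.log t) atTop (𝓝 0) := by
    refine squeeze_zero' (g := fun t : ℝ => t ^ (1 : ℝ) * Real.exp (-1 * t)) ?_ ?_
      (tendsto_rpow_mul_exp_neg_mul_atTop_nhds_zero 1 1 one_pos)
    · filter_upwards [eventually_ge_atTop 1] with t ht
      exact mul_nonneg (Real.exp_pos _).le (Real.log_nonneg ht)
    · filter_upwards [eventually_gt_atTop 0] with t ht
      have := Real.log_le_sub_one_of_pos ht
      rw [Real.rpow_one, mul_comm, neg_one_mul]
      gcongr
      linarith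
  have h := integral_Ioi_of_hasDerivAt_of_tendsto (a := 1)
    (f := fun t : ℝ => Real.exp (-t) * Real.log t)
    (f' := fun t : ℝ => Real.exp (-t) * t⁻¹ - Real.exp (-t) * Real.log t) ?_ ?_ (hi.sub hl) ht
  · rw [integral_sub hi hl] at h
    simp only [Real.log_one, mul_zero, sub_zero] at h
    linarith
  · refine ContinuousAt.continuousWithinAt ?_
    exact ContinuousAt.mul (by fun_prop) (Real.continuousAt_log one_ne_zero)
  · intro t ht
    have ht0 : t ≠ 0 := (zero_lt_one.trans (mem_Ioi.1 ht)).ne'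
    refine ((hasDerivAt_id t).neg.exp.mul (Real.hasDerivAt_log ht0)).congr_deriv ?_
    simp
    ring

/-- Both sides are `Γ'(1)`: the left by differentiating Euler's integral under the integral sign. -/
theorem integral_exp_neg_mul_log :
    ((∫ t in Ioi (0 : ℝ), Real.exp (-t) * Real.log t : ℝ) : ℂ) =
      -(Real.eulerMascheroniConstant : ℂ) := by
  have h1 := Complex.hasDerivAt_GammaIntegral (s := 1) (by simp)
  have h2 : Complex.GammaIntegral =ᶠ[𝓝 1] Complex.Gamma := by
    have : {s : ℂ | 0 < s.re} ∈ 𝓝 (1 : ℂ) :=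
      (isOpen_lt continuous_const Complex.continuous_re).mem_nhds (by simp)
    filter_upwards [this] with s hs
    exact (Complex.Gamma_eq_integral hs).symm
  rw [← (h1.congr_of_eventuallyEq h2.symm).unique Complex.hasDerivAt_Gamma_one,
    ← integral_complex_ofReal]
  refine integral_congr_ae (.of_forall fun t => ?_)
  simp [mul_comm]

/-- The classical expansion of `E₁(1)`. -/
theorem expIntegralAtOne_one :
    expIntegralAtOne 1 =
      (∑' n : ℕ, (-1 : ℂ) ^ n / ((Nat.factorial (n + 1) : ℂ) * ((n : ℂ) + 1))) -
        (Real.eulerMascheroniConstant : ℂ) := by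
  -- Split at `1`: the part over `(0,1]` is minus the series, the part over `(1,∞)` is `E₁(1)`.
  have h0 := integral_exp_neg_mul_log
  rw [← Ioc_union_Ioi_eq_Ioi (zero_le_one' ℝ),
      setIntegral_union (Ioc_disjoint_Ioi le_rfl) measurableSet_Ioi
        integrableOn_Ioc_exp_neg_mul_log integrableOn_Ioi_one_exp_neg_mul_log,
      Complex.ofReal_add, integral_Ioi_one_exp_neg_mul_log,
      ← hasSum_integral_Ioc_exp_neg_mul_log.tsum_eq, tsum_neg] at h0
  push_cast at h0
  linear_combination h0

theorem slavicConstant_eq : slavicConstant = Complex.exp 1 * expIntegralAtOne 1 - 1 := by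
  rw [slavicConstant, expIntegralAtOne_one]
  ring

theorem gammaStieltjes_two : gammaStieltjes 2 = -slavicConstant := by
  have h := expIntegralAtOne_add_one 1
  have hexp : Complex.exp 1 * Complex.exp (-1) = 1 := by rw [← Complex.exp_add]; simp
  have hG : Complex.Gamma 2 = 1 := by
    simp
  rw [one_add_one_eq_two] at h
  rw [gammaStieltjes_eq_Gamma_mul_expIntegralAtOne (by simp), slavicConstant_eq, hG]
  linear_combination Complex.exp 1 * h + hexp

/-! ### Closed form of the alternating Kurepa function -/

theorem kurepaIntegral_eq {z : ℂ} (hz : 0 < z.re) :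
    kurepaIntegral z = slavicConstant * (-1 : ℂ) ^ z +
      Complex.exp 1 * Complex.Gamma (z + 2) * expIntegralAtOne (z + 2) := by
  have hz2 : 0 < (z + 2).re := by simp; linarith
  rw [← gammaStieltjes_eq_Gamma_mul_expIntegralAtOne hz2,
    show slavicConstant * (-1 : ℂ) ^ z = -((-1 : ℂ) ^ z * gammaStieltjes 2) by
      rw [gammaStieltjes_two]; ring]
  have h2 : (0 : ℝ) < (2 : ℂ).re := by simp
  rw [kurepaIntegral, gammaStieltjes, gammaStieltjes, ← integral_const_mul, neg_add_eq_sub,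
    ← integral_sub (integrableOn_gammaStieltjes hz2)
      ((integrableOn_gammaStieltjes h2).const_mul _)]
  refine integral_congr_ae (.of_forall fun t => ?_)
  simp only [show z + 2 - 1 = z + 1 by ring, show (2 : ℂ) - 1 = 1 by norm_num, Complex.cpow_one]
  ring

theorem neg_one_cpow_add_one (z : ℂ) : (-1 : ℂ) ^ (z + 1) = -(-1 : ℂ) ^ z := by
  rw [Complex.cpow_add _ _ (by simp), Complex.cpow_one, mul_neg_one]

theorem kurepaStep_eq (n : ℕ) : ∀ z : ℂ, (∀ m : ℤ, z ≠ m) → -(n : ℝ) < z.re →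
    kurepaStep n z = slavicConstant * (-1 : ℂ) ^ z +
      Complex.exp 1 * Complex.Gamma (z + 2) * expIntegralAtOne (z + 2) := by
  induction n with
  | zero => exact fun z _ hre => kurepaIntegral_eq (by simpa using hre)
  | succ n ih =>
    intro z hz hre
    have hz1 : ∀ m : ℤ, z + 1 ≠ m := by simpa using sub_int_ne_int hz (-1)
    have hne : z + 2 ≠ 0 := by simpa using sub_int_ne_int hz (-2) 0
    have hG := Complex.Gamma_add_one (z + 2) hne
    have hE := expIntegralAtOne_add_one (z + 2)
    have hexp : Complex.exp 1 * Complex.exp (-1) = 1 := by rw [← Complex.exp_add]; simp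
    rw [kurepaStep, ih (z + 1) hz1 (by push_cast at hre; simp; linarith), neg_one_cpow_add_one,
      show z + 1 + 2 = z + 2 + 1 by ring, hG]
    linear_combination -Complex.exp 1 * Complex.Gamma (z + 2) * hE - Complex.Gamma (z + 2) * hexp

theorem alternatingKurepa_eq_expIntegralAtOne {z : ℂ} (hz : ∀ m : ℤ, z ≠ m) :
    alternatingKurepa z = slavicConstant * (-1 : ℂ) ^ z +
      Complex.exp 1 * Complex.Gamma (z + 2) * expIntegralAtOne (z + 2) := by
  refine kurepaStep_eq _ z hz ?_
  -- Truncation by `toNat` can only raise the step count, so it still exceeds `-Re z`.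
  have h1 := Int.lt_floor_add_one (-z.re)
  have h2 : ((⌊-z.re⌋ + 1 : ℤ) : ℝ) ≤ ((⌊-z.re⌋ + 1).toNat : ℝ) := by
    exact_mod_cast Int.self_le_toNat _
  push_cast at h2
  linarith

theorem hasSum_Gamma_add_one_sub {z : ℂ} (hz : ∀ m : ℤ, z ≠ m) :
    HasSum (fun n : ℕ => (-1 : ℂ) ^ n * Complex.Gamma (z + 1 - n))
      (Complex.exp 1 * Complex.Gamma (z + 2) * expIntegralAtOne (z + 2) -
        Real.pi * Complex.exp 1 / Complex.sin (Real.pi * z)) := by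
  have h := hasSum_Gamma_sub (s := z + 2) (by simpa using sub_int_ne_int hz (-2))
  have hs : Complex.sin (Real.pi * (z + 2)) = Complex.sin (Real.pi * z) := by
    rw [mul_add, mul_comm (Real.pi : ℂ) 2, Complex.sin_add_two_pi]
  rw [hs] at h
  simpa only [show z + 2 - 1 = z + 1 by ring] using h

theorem alternatingKurepa_eq {z : ℂ} (hz : ∀ m : ℤ, z ≠ m) :
    alternatingKurepa z = slavicConstant * (-1 : ℂ) ^ z
      + (Real.pi : ℂ) * Complex.exp 1 / Complex.sin ((Real.pi : ℂ) * z)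
      + ∑' n : ℕ, (-1 : ℂ) ^ n * Complex.Gamma (z + 1 - n) := by
  rw [alternatingKurepa_eq_expIntegralAtOne hz, (hasSum_Gamma_add_one_sub hz).tsum_eq]
  ring

/-! ### Uniform convergence away from the integers -/

theorem differentiableAt_Gamma_add_one_sub {z : ℂ} (hz : ∀ m : ℤ, z ≠ m) (n : ℕ) :
    DifferentiableAt ℂ (fun z => Complex.Gamma (z + 1 - n)) z := by
  refine DifferentiableAt.comp z (Complex.differentiableAt_Gamma _ fun m hm => ?_) (by fun_prop)
  exact hz (n - 1 - m) (by push_cast; linear_combination hm)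

/-- On a compact set without integers the terms have a summable uniform bound. -/
theorem exists_summable_bound_Gamma_sub {S : Set ℂ} (hS : IsCompact S)
    (hint : ∀ z ∈ S, ∀ m : ℤ, z ≠ m) :
    ∃ u : ℕ → ℝ, Summable u ∧ ∀ n : ℕ, ∀ z ∈ S, ‖Complex.Gamma (z + 1 - n)‖ ≤ u n := by
  rcases S.eq_empty_or_nonempty with rfl | hne
  · exact ⟨0, summable_zero, by simp⟩
  -- The bound `u n` is the maximum of the `n`-th term itself, at a point depending on `n`.
  have hmax : ∀ n : ℕ, ∃ w ∈ S, ∀ z ∈ S,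
      ‖Complex.Gamma (z + 1 - n)‖ ≤ ‖Complex.Gamma (w + 1 - n)‖ := by
    intro n
    obtain ⟨w, hw, h⟩ := hS.exists_isMaxOn (f := fun z => ‖Complex.Gamma (z + 1 - n)‖) hne
      fun z hz =>
        (differentiableAt_Gamma_add_one_sub (hint z hz) n).continuousAt.norm.continuousWithinAt
    exact ⟨w, hw, h⟩
  choose w hw hle using hmax
  refine ⟨fun n => ‖Complex.Gamma (w n + 1 - n)‖, ?_, hle⟩
  obtain ⟨B, hB⟩ := hS.isBounded.exists_norm_le
  obtain ⟨N, hN⟩ := exists_nat_gt (B + 2)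
  refine summable_of_ratio_norm_eventually_le (r := 1 / 2) (by norm_num) ?_
  filter_upwards [eventually_ge_atTop N] with n hn
  -- At the maximiser `x` for `n + 1`, `Γ(x + 1 - n) = (x - n) Γ(x - n)` with `|x - n| ≥ 2`, so
  -- successive maxima at least halve.
  set x := w (n + 1) with hx
  have hx1 : x ∈ S := hw _
  have hxn : x - n ≠ 0 := by simpa using sub_int_ne_int (hint x hx1) n 0
  have hG := Complex.Gamma_add_one (x - n) hxn
  have h2 : 2 ≤ ‖x - n‖ := by
    have h3 := norm_sub_norm_le (n : ℂ) x
    rw [Complex.norm_natCast, norm_sub_rev] at h3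
    have h4 := hB x hx1
    have h5 : (N : ℝ) ≤ n := by exact_mod_cast hn
    linarith
  have h6 := hle n x hx1
  rw [show x + 1 - n = x - n + 1 by ring, hG, norm_mul] at h6
  rw [norm_norm, norm_norm, show x + 1 - ((n + 1 : ℕ) : ℂ) = x - n by push_cast; ring]
  nlinarith [norm_nonneg (Complex.Gamma (x - n))]

/-! ### Calculus of principal values -/

theorem HasPrincipalValue.of_eqOn_Ioo {f : ℂ → ℂ} {a c : ℂ} {r : ℝ} (hr : 0 < r)
    (h : ∀ ρ ∈ Ioo 0 r, CircleIntegrable (fun z => f z / (z - a)) a ρ ∧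
      1 / (2 * (Real.pi : ℂ) * Complex.I) * (∮ z in C(a, ρ), f z / (z - a)) = c) :
    HasPrincipalValue f a c := by
  have hm : Ioo 0 r ∈ 𝓝[>] (0 : ℝ) := Ioo_mem_nhdsGT hr
  refine ⟨?_, tendsto_const_nhds.congr' ?_⟩
  · filter_upwards [hm] with ρ hρ using (h ρ hρ).1
  · filter_upwards [hm] with ρ hρ using (h ρ hρ).2.symm

/-- Only small circles matter, so the value at the centre, possibly a pole, is irrelevant. -/
theorem HasPrincipalValue.congr_Ioo {f g : ℂ → ℂ} {a c : ℂ} (hf : HasPrincipalValue f a c) {r : ℝ}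
    (hr : 0 < r) (h : ∀ ρ ∈ Ioo 0 r, EqOn f g (Metric.sphere a ρ)) : HasPrincipalValue g a c := by
  have hm : Ioo 0 r ∈ 𝓝[>] (0 : ℝ) := Ioo_mem_nhdsGT hr
  have hq : ∀ ρ ∈ Ioo 0 r, EqOn (fun z => f z / (z - a)) (fun z => g z / (z - a))
      (Metric.sphere a ρ) := fun ρ hρ z hz => by simp only [h ρ hρ hz]
  refine ⟨?_, hf.2.congr' ?_⟩
  · filter_upwards [hm, hf.1] with ρ hρ hi
    exact (circleIntegrable_congr (by rw [abs_of_pos hρ.1]; exact hq ρ hρ)).1 hi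
  · filter_upwards [hm] with ρ hρ
    rw [circleIntegral.integral_congr hρ.1.le (hq ρ hρ)]

theorem HasPrincipalValue.add {f g : ℂ → ℂ} {a c d : ℂ} (hf : HasPrincipalValue f a c)
    (hg : HasPrincipalValue g a d) : HasPrincipalValue (fun z => f z + g z) a (c + d) := by
  refine ⟨?_, (hf.2.add hg.2).congr' ?_⟩
  · filter_upwards [hf.1, hg.1] with ρ h1 h2
    simp only [add_div]
    exact h1.add h2
  · filter_upwards [hf.1, hg.1] with ρ h1 h2
    simp only [add_div]
    rw [circleIntegral.integral_add h1 h2, mul_add]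

theorem continuousOn_div_sub_sphere {f : ℂ → ℂ} {a : ℂ} {ρ : ℝ} (hρ : 0 < ρ)
    (hf : ContinuousOn f (Metric.sphere a ρ)) :
    ContinuousOn (fun z => f z / (z - a)) (Metric.sphere a ρ) := by
  refine hf.div (by fun_prop) fun z hz => sub_ne_zero.2 ?_
  rintro rfl
  simp [hρ.ne] at hz

/-- Cauchy's integral formula at the centre. -/
theorem HasPrincipalValue.of_differentiableAt {f : ℂ → ℂ} {a : ℂ} {r : ℝ} (hr : 0 < r)
    (hf : ∀ z ∈ Metric.ball a r, DifferentiableAt ℂ f z) : HasPrincipalValue f a (f a) := by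
  refine .of_eqOn_Ioo hr fun ρ hρ => ?_
  have hsub : Metric.closedBall a ρ ⊆ Metric.ball a r := Metric.closedBall_subset_ball hρ.2
  have hc : ContinuousOn f (Metric.closedBall a ρ) := fun z hz =>
    (hf z (hsub hz)).continuousAt.continuousWithinAt
  refine ⟨(continuousOn_div_sub_sphere hρ.1
    (hc.mono Metric.sphere_subset_closedBall)).circleIntegrable hρ.1.le, ?_⟩
  have h := Complex.circleIntegral_sub_inv_smul_of_differentiable_on_off_countable
    countable_empty (Metric.mem_ball_self hρ.1) hc
    fun z hz => hf z (hsub (Metric.ball_subset_closedBall hz.1))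
  simp only [smul_eq_mul, inv_mul_eq_div] at h
  rw [h]
  field_simp [Complex.two_pi_I_ne_zero]

/-- If `f` is holomorphic on a punctured disc, the circle integrals do not depend on the radius. -/
theorem circleIntegral_div_sub_eq {f : ℂ → ℂ} {a : ℂ} {r : ℝ}
    (hf : ∀ z ∈ Metric.ball a r, z ≠ a → DifferentiableAt ℂ f z) {ρ₁ ρ₂ : ℝ}
    (h₁ : ρ₁ ∈ Ioo 0 r) (h₂ : ρ₂ ∈ Ioo 0 r) :
    (∮ z in C(a, ρ₁), f z / (z - a)) = ∮ z in C(a, ρ₂), f z / (z - a) := by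
  wlog h : ρ₁ ≤ ρ₂ generalizing ρ₁ ρ₂
  · exact (this h₂ h₁ (le_of_not_ge h)).symm
  have hd : ∀ z ∈ Metric.closedBall a ρ₂ \ Metric.ball a ρ₁, DifferentiableAt ℂ f z := by
    refine fun z hz => hf z (Metric.closedBall_subset_ball h₂.2 hz.1) ?_
    rintro rfl
    exact hz.2 (Metric.mem_ball_self h₁.1)
  have := Complex.circleIntegral_sub_center_inv_smul_eq_of_differentiable_on_annulus_off_countable
    h₁.1 h countable_empty (fun z hz => (hd z hz).continuousAt.continuousWithinAt)
    fun z hz => hd z ⟨Metric.ball_subset_closedBall hz.1.1,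
      fun hz' => hz.1.2 (Metric.ball_subset_closedBall hz')⟩
  simpa only [smul_eq_mul, inv_mul_eq_div] using this.symm

theorem HasPrincipalValue.of_punctured {f : ℂ → ℂ} {a : ℂ} {r : ℝ}
    (hf : ∀ z ∈ Metric.ball a r, z ≠ a → DifferentiableAt ℂ f z) {ρ₀ : ℝ} (h₀ : ρ₀ ∈ Ioo 0 r) :
    HasPrincipalValue f a
      (1 / (2 * (Real.pi : ℂ) * Complex.I) * ∮ z in C(a, ρ₀), f z / (z - a)) := by
  refine .of_eqOn_Ioo (h₀.1.trans h₀.2) fun ρ hρ => ⟨?_, by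
    rw [circleIntegral_div_sub_eq hf hρ h₀]⟩
  refine (continuousOn_div_sub_sphere hρ.1 fun z hz => ?_).circleIntegrable hρ.1.le
  refine (hf z (Metric.sphere_subset_ball hρ.2 hz) ?_).continuousAt.continuousWithinAt
  rintro rfl
  simp [hρ.1.ne] at hz

/-! ### The formula at the integers -/

theorem ne_int_of_mem_ball {m : ℤ} {z : ℂ} (hz : z ∈ Metric.ball (m : ℂ) 1) (hne : z ≠ m) (k : ℤ) :
    z ≠ k := by
  rintro rfl
  rw [Metric.mem_ball, dist_eq_norm, ← Int.cast_sub, Complex.norm_intCast] at hz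
  have h1 : |k - m| < 1 := by exact_mod_cast hz
  exact hne (by rw [sub_eq_zero.1 (Int.abs_lt_one_iff.1 h1)])

theorem ne_int_of_mem_sphere {m : ℤ} {ρ : ℝ} (hρ : ρ ∈ Ioo 0 1) {z : ℂ}
    (hz : z ∈ Metric.sphere (m : ℂ) ρ) (k : ℤ) : z ≠ k := by
  refine ne_int_of_mem_ball (Metric.sphere_subset_ball hρ.2 hz) ?_ k
  rintro rfl
  simp [hρ.1.ne] at hz

/-- On a circle of radius less than one about an integer the series is integrated termwise. -/
theorem circleIntegral_alternatingGammaSum {m : ℤ} {ρ : ℝ} (hρ : ρ ∈ Ioo 0 1) :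
    CircleIntegrable (fun z => alternatingGammaSum z / (z - m)) m ρ ∧
    HasSum (fun n : ℕ => (-1 : ℂ) ^ n * ∮ z in C(m, ρ), Complex.Gamma (z + 1 - n) / (z - m))
      (∮ z in C(m, ρ), alternatingGammaSum z / (z - m)) := by
  have hS : ∀ z ∈ Metric.sphere (m : ℂ) ρ, ∀ k : ℤ, z ≠ k := fun z => ne_int_of_mem_sphere hρ
  obtain ⟨u, hu, hle⟩ := exists_summable_bound_Gamma_sub (isCompact_sphere (m : ℂ) ρ) hS
  have hc : ∀ n : ℕ, ContinuousOn (fun z => Complex.Gamma (z + 1 - n)) (Metric.sphere (m : ℂ) ρ) :=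
    fun n z hz => (differentiableAt_Gamma_add_one_sub (hS z hz) n).continuousAt.continuousWithinAt
  have hsum : ContinuousOn alternatingGammaSum (Metric.sphere (m : ℂ) ρ) :=
    continuousOn_tsum (fun n => (hc n).const_mul _) hu fun n z hz => by simpa using hle n z hz
  refine ⟨(continuousOn_div_sub_sphere hρ.1 hsum).circleIntegrable hρ.1.le, ?_⟩
  have hcd : ∀ n : ℕ, ContinuousOn (fun z => (-1 : ℂ) ^ n * (Complex.Gamma (z + 1 - n) / (z - m)))
      (Metric.sphere (m : ℂ) ρ) := fun n => (continuousOn_div_sub_sphere hρ.1 (hc n)).const_mul _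
  -- Dividing by `|z - m| = ρ` keeps the bound summable. The uniform limit is over finite index
  -- sets, so integrating it gives `HasSum` directly.
  have hunif := tendstoUniformlyOn_tsum (hu.div_const ρ) (s := Metric.sphere (m : ℂ) ρ)
    (f := fun (n : ℕ) z => (-1 : ℂ) ^ n * (Complex.Gamma (z + 1 - n) / (z - m))) fun n z hz => by
      rw [norm_mul, norm_pow, norm_neg, norm_one, one_pow, one_mul, norm_div,
        mem_sphere_iff_norm.1 hz]
      exact div_le_div_of_nonneg_right (hle n z hz) hρ.1.le
  have h := hunif.tendsto_circleIntegral_of_continuousOn hρ.1.le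
    (.of_forall fun s => continuousOn_finsetSum s fun n _ => hcd n)
  have hA : (∮ z in C(m, ρ), alternatingGammaSum z / (z - m)) =
      ∮ z in C(m, ρ), ∑' n : ℕ, (-1 : ℂ) ^ n * (Complex.Gamma (z + 1 - n) / (z - m)) := by
    refine circleIntegral.integral_congr hρ.1.le fun z _ => ?_
    simp only [alternatingGammaSum, ← tsum_div_const, mul_div_assoc]
  rw [hA, HasSum, SummationFilter.unconditional_filter]
  refine h.congr fun s => ?_
  rw [circleIntegral.integral_fun_sum fun n _ => (hcd n).circleIntegrable hρ.1.le]
  exact Finset.sum_congr rfl fun n _ => circleIntegral.integral_const_mul _ _ _ _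

theorem mainTheorem10 :
    -- the series in the constant converges
    Summable (fun n : ℕ => (-1 : ℂ) ^ n / ((Nat.factorial (n + 1) : ℂ) * ((n : ℂ) + 1))) ∧
    -- the formula at the points that are not integers
    (∀ z : ℂ, (∀ m : ℤ, z ≠ (m : ℂ)) →
      Summable (fun n : ℕ => (-1 : ℂ) ^ n * Complex.Gamma (z + 1 - n)) ∧
      alternatingKurepa z =
        slavicConstant * (-1 : ℂ) ^ z
          + (Real.pi : ℂ) * Complex.exp 1 / Complex.sin ((Real.pi : ℂ) * z)
          + ∑' n : ℕ, (-1 : ℂ) ^ n * Complex.Gamma (z + 1 - n)) ∧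
    -- the formula at the integers, for principal values: `a`, `s`, `l`, `g n` are those of `A(z)`,
    -- of `π e / sin (π z)`, of the sum of the series and of its terms `Γ(z + 1 - n)`
    (∀ m : ℤ, ∃ (a s l : ℂ) (g : ℕ → ℂ),
      HasPrincipalValue alternatingKurepa (m : ℂ) a ∧
      HasPrincipalValue
        (fun z => (Real.pi : ℂ) * Complex.exp 1 / Complex.sin ((Real.pi : ℂ) * z)) (m : ℂ) s ∧
      HasPrincipalValue alternatingGammaSum (m : ℂ) l ∧
      (∀ n : ℕ, HasPrincipalValue (fun z => Complex.Gamma (z + 1 - n)) (m : ℂ) (g n)) ∧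
      HasSum (fun n : ℕ => (-1 : ℂ) ^ n * g n) l ∧
      a = slavicConstant * (-1 : ℂ) ^ (m : ℂ) + s + l) := by
  refine ⟨summable_slavic,
    fun z hz => ⟨(hasSum_Gamma_add_one_sub hz).summable, alternatingKurepa_eq hz⟩, fun m => ?_⟩
  have hhalf : (1 / 2 : ℝ) ∈ Ioo 0 1 := by norm_num
  have hg : ∀ n : ℕ, ∀ z ∈ Metric.ball (m : ℂ) 1, z ≠ m →
      DifferentiableAt ℂ (fun z => Complex.Gamma (z + 1 - n)) z := fun n z hz hne =>
    differentiableAt_Gamma_add_one_sub (ne_int_of_mem_ball hz hne) n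
  have hs := HasPrincipalValue.of_punctured (a := m) (r := 1) (f := fun z =>
      (Real.pi : ℂ) * Complex.exp 1 / Complex.sin ((Real.pi : ℂ) * z)) (fun z hz hne => by
    refine DifferentiableAt.div (by fun_prop) (by fun_prop) (sin_pi_mul_ne_zero ?_)
    rintro ⟨k, hk⟩
    exact ne_int_of_mem_ball hz hne k hk.symm) hhalf
  have hl : HasPrincipalValue alternatingGammaSum m
      (1 / (2 * (Real.pi : ℂ) * Complex.I) *
        ∮ z in C(m, 1 / 2), alternatingGammaSum z / (z - m)) := by
    refine .of_eqOn_Ioo one_pos fun ρ hρ => ⟨(circleIntegral_alternatingGammaSum hρ).1, ?_⟩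
    congr 1
    -- Each term's integral is independent of the radius, hence so is the sum; holomorphy of the sum
    -- is not needed.
    refine (circleIntegral_alternatingGammaSum hρ).2.unique ?_
    simpa only [circleIntegral_div_sub_eq (hg _) hρ hhalf] using
      (circleIntegral_alternatingGammaSum hhalf).2
  have hp := HasPrincipalValue.of_differentiableAt (a := m) one_pos
    (f := fun z => slavicConstant * (-1 : ℂ) ^ z) fun z _ =>
      (differentiableAt_id.const_cpow (.inl (by simp))).const_mul _
  refine ⟨_, _, _, _, ((hp.add hs).add hl).congr_Ioo one_pos fun ρ hρ z hz => ?_, hs, hl,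
    fun n => .of_punctured (hg n) hhalf, ?_, rfl⟩
  · exact (alternatingKurepa_eq (ne_int_of_mem_sphere hρ hz)).symm
  · simpa only [mul_left_comm (1 / (2 * (Real.pi : ℂ) * Complex.I))] using
      (circleIntegral_alternatingGammaSum (m := m) hhalf).2.mul_left
        (1 / (2 * (Real.pi : ℂ) * Complex.I))
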